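/- **Proposition 5.4.** *Planar algebras.* A $k$-box is a rectangle with $k$ marked points on its upper side and $k$ on its lower side ($k\ge 0$). A $(k_1,\dots,k_r,k)$-tangle consists of disjoint input $k_i$-boxes inside an output $k$-box, non-crossing strings in the complement of the input boxes pairing all the marked points, and finitely many closed strings; the regions of the picture are required to admit a checkerboard shading for which the region touching the left side of each box, input or output, is unshaded. Tangles are taken up to planar isotopy. A planar algebra is a sequence $P=(P_k)_{k\ge 0}$ of complex vector spaces with a multilinear map $T:P_{k_1}\times\dots\times P_{k_r}\to P_k$ for each tangle $T$, compatible with the gluing of tangles and the renumbering of input boxes, the identity tangles acting as identities. Each $P_k$ is then a unital algebra, with product given by the tangle stacking two $k$-boxes and unit given by the tangle with $k$ vertical strings and no input box, and the tangle adding a vertical string at right gives maps $I_k:P_k\to P_{k+1}$. A tangle is called annular if it has at most one input box. *Quantum groups.* Let $G$ be a unitary compact quantum group of Kac type, that is, let $C(G)$ be a unital $C^*$-algebra generated by the entries of a unitary matrix $u\in M_N(C(G))$, such that there exist morphisms of unital $C^*$-algebras $\Delta:C(G)\to C(G)\otimes C(G)$, $\varepsilon:C(G)\to\mathbb C$, $S:C(G)\to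 C(G)^{opp}$ with $\Delta(u_{ij})=\sum_k u_{ik}\otimes u_{kj}$, $\varepsilon(u_{ij})=\delta_{ij}$, $S(u_{ij})=u_{ji}^*$ (spatial tensor product). Let $C^\infty(G)$ be the $*$-algebra generated by the $u_{ij}$, and let $L^\infty(G)$ be the von Neumann algebra generated by $C(G)$ in the GNS representation of its Haar state. *Coactions.* Let $P$ be a planar algebra with finite dimensional spaces $P_k$. A coaction of $L^\infty(G)$ on $P$ is a family of injective morphisms of unital algebras $\alpha_k:P_k\to L^\infty(G)\otimes P_k$, taking values in $C^\infty(G)\otimes P_k$, coassociative in the sense that $(\mathrm{id}\otimes\alpha_k)\alpha_k=(\Delta\otimes \mathrm{id})\alpha_k$, compatible with the inclusions in the sense that $(\mathrm{id}\otimes I_k)\alpha_k=\alpha_{k+1}I_k$, and such that all annular tangles are weakly $G$-equivariant, that is, send fixed points to fixed points, where the space of fixed points of $\alpha_k$ is $P_k^G=\{x\in P_k\mid \alpha_k(x)=1\otimes x\}$. (For a tangle without input box, this means that the element of $P_k$ which it defines is fixed.) *Statement.* If $\alpha$ is a coaction of $L^\infty(G)$ on $P$, then the graded vector space $P^G=(P_k^G)_{k\ge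 0}$ is a planar algebra, with the action of tangles obtained by restricting the one on $P$. In particular every tangle maps $P_{k_1}^G\times\dots\times P_{k_r}^G$ into $P_k^G$. -/

import Mathlib

open scoped TensorProduct ComplexOrder

/-! ### Planar tangles

A tangle is drawn in generic position in its output box and read from top to bottom, as a
finite sequence of layers.  Each layer contains exactly one piece: a local maximum of a string,
a local minimum of a string, or an input box; all the other strings cross the layer vertically.
Tangles are considered up to planar isotopy. -/

namespace Planar

/-- The piece which distinguishes a layer. Input boxes are labelled by the elements of `ι`. -/
inductive Piece (ι : Type*) where
  /-- a local maximum of a string: two new strands appear below it -/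
  | maximum : Piece ι
  /-- a local minimum of a string: two neighbouring strands are joined -/
  | minimum : Piece ι
  /-- the input box with label `j` -/
  | box (j : ι) : Piece ι

namespace Piece

variable {ι κ : Type*}

/-- The number of strands that enter a piece from above; `k j` is the size of the box `j`,
which has `k j` marked points on its upper side and `k j` on its lower side. -/
def top (k : ι → ℕ) : Piece ι → ℕ
  | maximum => 0
  | minimum => 2
  | box j => k j

/-- The number of strands that leave a piece from below. -/
def bot (k : ι → ℕ) : Piece ι → ℕ
  | maximum => 2
  | minimum => 0
  | box j => k j

/-- The label of the box, if the piece is a box. -/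
def label : Piece ι → Option ι
  | maximum => none
  | minimum => none
  | box j => some j

/-- Change of labels. -/
def map (f : ι → κ) : Piece ι → Piece κ
  | maximum => maximum
  | minimum => minimum
  | box j => box (f j)

end Piece

/-- A layer: the piece, and the number of strands that pass on its left. -/
structure Layer (ι : Type*) where
  left : ℕ
  piece : Piece ι

/-- Translation of a layer to the right by `a` strands, with change of labels. -/
def Layer.shift {ι κ : Type*} (a : ℕ) (f : ι → κ) (L : Layer ι) : Layer κ :=
  ⟨a + L.left, L.piece.map f⟩

/-- `Runs k n w m`: the sequence of layers `w` makes sense as a picture with `n` strands on top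
and `m` strands at the bottom.  The regions of a picture are shaded in alternating fashion, the
leftmost one being unshaded; the parity rule for marked points is that the region which touches
the left side of a box is unshaded, which means that an even number of strands passes on the
left of the box. -/
def Runs {ι : Type*} (k : ι → ℕ) : ℕ → List (Layer ι) → ℕ → Prop
  | n, [], m => n = m
  | n, L :: w, m => L.left + L.piece.top k ≤ n ∧ (∀ j, L.piece = Piece.box j → Even L.left) ∧
      Runs k (n - L.piece.top k + L.piece.bot k) w m

/-- The labels of the boxes occurring in a picture. -/
def labels {ι : Type*} (w : List (Layer ι)) : List ι := w.filterMap fun L => L.piece.label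

/-- A tangle (drawn in generic position) with input boxes labelled by `ι`, the box `j` being a
`k j`-box, and with an `n`-box as output. Every input box occurs exactly once; in particular
`ι` is finite. -/
structure Tangle {ι : Type*} (k : ι → ℕ) (n : ℕ) where
  layers : List (Layer ι)
  runs : Runs k n layers n
  nodup : (labels layers).Nodup
  mem_labels : ∀ j, j ∈ labels layers

/-- `m` nested local maxima, whose `2 * m` legs come after `a` strands. -/
def nestedMaxima {ι : Type*} (a m : ℕ) : List (Layer ι) :=
  (List.range m).map fun i => ⟨a + i, Piece.maximum⟩

/-- `m` nested local minima, whose `2 * m` legs come after `a` strands. -/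
def nestedMinima {ι : Type*} (a m : ℕ) : List (Layer ι) :=
  (List.range m).reverse.map fun i => ⟨a + i, Piece.minimum⟩

/-- The elementary planar isotopies: two pieces, one of which lies on the left of the other,
exchange their heights; a zigzag is straightened; a box, which has been turned upside
down clockwise with the strings attached to it, can be turned upside down counterclockwise
instead (that is, a full rotation of a box is an isotopy). -/
inductive Move {ι : Type*} (k : ι → ℕ) : List (Layer ι) → List (Layer ι) → Prop
  | exchange (a c : ℕ) (p q : Piece ι) (h : a ≤ c) :
      Move k [⟨a, p⟩, ⟨c + p.bot k, q⟩] [⟨c + p.top k, q⟩, ⟨a, p⟩]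
  | zigzag (a : ℕ) : Move k [⟨a, Piece.maximum⟩, ⟨a + 1, Piece.minimum⟩] []
  | zagzig (a : ℕ) : Move k [⟨a + 1, Piece.maximum⟩, ⟨a, Piece.minimum⟩] []
  | rotate (a : ℕ) (j : ι) :
      Move k (nestedMaxima (a + k j) (k j) ++ [⟨a + k j, Piece.box j⟩] ++ nestedMinima a (k j))
        (nestedMaxima a (k j) ++ [⟨a + k j, Piece.box j⟩] ++ nestedMinima (a + k j) (k j))

section Lemmas

variable {ι κ : Type*}

theorem Piece.top_map (k : κ → ℕ) (f : ι → κ) (p : Piece ι) :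
    (p.map f).top k = p.top (k ∘ f) := by cases p <;> rfl

theorem Piece.bot_map (k : κ → ℕ) (f : ι → κ) (p : Piece ι) :
    (p.map f).bot k = p.bot (k ∘ f) := by cases p <;> rfl

theorem Piece.label_map (f : ι → κ) (p : Piece ι) : (p.map f).label = p.label.map f := by
  cases p <;> rfl

theorem Runs.append {k : ι → ℕ} {w w' : List (Layer ι)} {n m r : ℕ} (h : Runs k n w m)
    (h' : Runs k m w' r) : Runs k n (w ++ w') r := by
  induction w generalizing n with
  | nil => cases h; exact h'
  | cons L w ih => exact ⟨h.1, h.2.1, ih h.2.2⟩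

theorem Runs.shift {k : κ → ℕ} (f : ι → κ) {w : List (Layer ι)} {n m : ℕ}
    (h : Runs (k ∘ f) n w m) {a : ℕ} (ha : Even a) (b : ℕ) :
    Runs k (a + n + b) (w.map (Layer.shift a f)) (a + m + b) := by
  induction w generalizing n with
  | nil => cases h; rfl
  | cons L w ih =>
    obtain ⟨h1, h2, h3⟩ := h
    have h3' := ih h3
    refine ⟨?_, ?_, ?_⟩
    · simp only [Layer.shift, Piece.top_map]; omega
    · intro j hj
      refine ha.add ?_
      obtain ⟨l, p⟩ := L
      cases p with
      | maximum => cases hj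
      | minimum => cases hj
      | box i => exact h2 i rfl
    · simp only [Layer.shift, Piece.top_map, Piece.bot_map]
      have : a + n + b - L.piece.top (k ∘ f) + L.piece.bot (k ∘ f) =
          a + (n - L.piece.top (k ∘ f) + L.piece.bot (k ∘ f)) + b := by omega
      rw [this]
      exact h3'

theorem labels_shift (f : ι → κ) (a : ℕ) (w : List (Layer ι)) :
    labels (w.map (Layer.shift a f)) = (labels w).map f := by
  induction w with
  | nil => rfl
  | cons L w ih =>
    obtain ⟨l, p⟩ := L
    cases p <;> simpa [labels, Layer.shift, Piece.label, Piece.map] using ih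

end Lemmas

namespace Tangle

variable {ι κ : Type*}

/-- Two tangles differ by an elementary isotopy, inside an otherwise unchanged picture. -/
def Step {k : ι → ℕ} {n : ℕ} (T T' : Tangle k n) : Prop :=
  ∃ u v w w', Move k w w' ∧ T.layers = u ++ w ++ v ∧ T'.layers = u ++ w' ++ v

/-- Planar isotopy. -/
def Isotopic {k : ι → ℕ} {n : ℕ} : Tangle k n → Tangle k n → Prop := Relation.EqvGen Step

/-- Renaming of the input boxes. -/
def relabel {k : κ → ℕ} {n : ℕ} (e : ι ≃ κ) (T : Tangle (k ∘ e) n) : Tangle k n where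
  layers := T.layers.map (Layer.shift 0 e)
  runs := by simpa using T.runs.shift (k := k) e (a := 0) (by simp) 0
  nodup := by rw [labels_shift]; exact T.nodup.map e.injective
  mem_labels j := by
    rw [labels_shift]
    exact List.mem_map.2 ⟨e.symm j, T.mem_labels _, by simp⟩

/-- What becomes of a layer when pictures are put into the boxes. -/
def fill {κ : ι → Type*} (S : ∀ j, List (Layer (κ j))) :
    Layer ι → List (Layer (Σ j, κ j))
  | ⟨a, Piece.maximum⟩ => [⟨a, Piece.maximum⟩]
  | ⟨a, Piece.minimum⟩ => [⟨a, Piece.minimum⟩]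
  | ⟨a, Piece.box j⟩ => (S j).map (Layer.shift a (Sigma.mk j))

theorem runs_fill {κ : ι → Type*} {k : ι → ℕ} {l : ∀ j, κ j → ℕ} (S : ∀ j, Tangle (l j) (k j))
    {w : List (Layer ι)} {n m : ℕ} (h : Runs k n w m) :
    Runs (fun p : Σ j, κ j => l p.1 p.2) n (w.flatMap (fill fun j => (S j).layers)) m := by
  induction w generalizing n with
  | nil => exact h
  | cons L w ih =>
    obtain ⟨h1, h2, h3⟩ := h
    rw [List.flatMap_cons]
    refine Runs.append ?_ (ih h3)
    obtain ⟨a, p⟩ := L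
    cases p with
    | maximum => exact ⟨h1, by intro j hj; contradiction, rfl⟩
    | minimum => exact ⟨h1, by intro j hj; contradiction, rfl⟩
    | box j =>
      simp only [Piece.top, Piece.bot] at h1 ⊢
      have := (S j).runs.shift (k := fun p : Σ j, κ j => l p.1 p.2) (Sigma.mk j)
        (h2 j rfl) (n - (a + k j))
      have e : a + k j + (n - (a + k j)) = n := by omega
      rw [e] at this
      have e' : n - k j + k j = n := by omega
      rw [e']
      exact this

theorem labels_fill {κ : ι → Type*} (S : ∀ j, List (Layer (κ j))) (w : List (Layer ι)) :
    labels (w.flatMap (fill S)) =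
      (labels w).flatMap fun j => (labels (S j)).map (Sigma.mk j) := by
  induction w with
  | nil => rfl
  | cons L w ih =>
    obtain ⟨a, p⟩ := L
    have happ : ∀ u v : List (Layer (Σ j, κ j)), labels (u ++ v) = labels u ++ labels v :=
      fun u v => List.filterMap_append
    rw [List.flatMap_cons, happ, ih]
    cases p with
    | maximum => simp [labels, fill, Piece.label]
    | minimum => simp [labels, fill, Piece.label]
    | box j =>
      have h1 : labels (fill S ⟨a, Piece.box j⟩) = (labels (S j)).map (Sigma.mk j) :=
        labels_shift _ _ _
      have h2 : labels (⟨a, Piece.box j⟩ :: w) = j :: labels w := by simp [labels, Piece.label]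
      rw [h1, h2, List.flatMap_cons]

/-- Gluing of tangles: for each `j`, the tangle `S j` is put into the input box `j` of `T`. -/
def glue {κ : ι → Type*} {k : ι → ℕ} {n : ℕ} {l : ∀ j, κ j → ℕ} (T : Tangle k n)
    (S : ∀ j, Tangle (l j) (k j)) : Tangle (fun p : Σ j, κ j => l p.1 p.2) n where
  layers := T.layers.flatMap (fill fun j => (S j).layers)
  runs := runs_fill S T.runs
  nodup := by
    rw [labels_fill, List.nodup_flatMap]
    refine ⟨fun j _ => (S j).nodup.map sigma_mk_injective, T.nodup.imp fun {i j} hij => ?_⟩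
    rw [Function.onFun, List.disjoint_left]
    intro p hp hp'
    obtain ⟨x, -, rfl⟩ := List.mem_map.1 hp
    obtain ⟨y, -, hy⟩ := List.mem_map.1 hp'
    exact hij (congrArg Sigma.fst hy).symm
  mem_labels := by
    rintro ⟨j, x⟩
    rw [labels_fill, List.mem_flatMap]
    exact ⟨j, T.mem_labels j, List.mem_map.2 ⟨x, (S j).mem_labels x, rfl⟩⟩

/-- The identity tangle: an `n`-box in an `n`-box, joined by `2 * n` vertical strings. -/
def id (n : ℕ) : Tangle (fun _ : Unit => n) n where
  layers := [⟨0, Piece.box ()⟩]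
  runs := by simp [Runs, Piece.top, Piece.bot]
  nodup := by simp [labels, Piece.label]
  mem_labels := by simp [labels, Piece.label]

/-- The unit tangle: no input box, `n` vertical strings. -/
def unit (n : ℕ) : Tangle (fun _ : Fin 0 => 0) n where
  layers := []
  runs := rfl
  nodup := by simp [labels]
  mem_labels j := j.elim0

/-- The multiplication tangle: two `n`-boxes on top of each other, joined by vertical strings,
the first input being the lower box. -/
def mul (n : ℕ) : Tangle (fun _ : Fin 2 => n) n where
  layers := [⟨0, Piece.box 1⟩, ⟨0, Piece.box 0⟩]
  runs := by simp [Runs, Piece.top, Piece.bot]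
  nodup := by simp [labels, Piece.label]
  mem_labels := by simp [labels, Piece.label, Fin.forall_fin_two]

/-- The inclusion tangle: like the identity, with an extra vertical string at right. -/
def incl (n : ℕ) : Tangle (fun _ : Unit => n) (n + 1) where
  layers := [⟨0, Piece.box ()⟩]
  runs := by
    simp only [Runs, Piece.top, Piece.bot]
    refine ⟨by omega, fun _ _ => by simp, by omega⟩
  nodup := by simp [labels, Piece.label]
  mem_labels := by simp [labels, Piece.label]

end Tangle

end Planar

open Planar

/-- A planar algebra: an algebra over the operad of planar tangles. Each tangle acts on the graded
vector space `V` by a multilinear map, which depends only on the isotopy class of the tangle, and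
these maps are compatible with the numbering of the input boxes and with the gluing of tangles. -/
structure PlanarAlgebra (V : ℕ → Type*) [∀ n, AddCommGroup (V n)] [∀ n, Module ℂ (V n)] where
  act : ∀ {ι : Type} {k : ι → ℕ} {n : ℕ}, Tangle k n →
    MultilinearMap ℂ (fun j => V (k j)) (V n)
  act_isotopic : ∀ {ι : Type} {k : ι → ℕ} {n : ℕ} {T T' : Tangle k n}, T.Isotopic T' →
    act T = act T'
  act_relabel : ∀ {ι κ : Type} {k : κ → ℕ} {n : ℕ} (e : ι ≃ κ) (T : Tangle (k ∘ e) n)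
    (x : ∀ j, V (k j)), act (T.relabel e) x = act T fun i => x (e i)
  act_id : ∀ (n : ℕ) (x : V n), act (Tangle.id n) (fun _ => x) = x
  act_glue : ∀ {ι : Type} {κ : ι → Type} {k : ι → ℕ} {n : ℕ} {l : ∀ j, κ j → ℕ}
    (T : Tangle k n) (S : ∀ j, Tangle (l j) (k j)) (x : ∀ p : Σ j, κ j, V (l p.1 p.2)),
    act (T.glue S) x = act T fun j => act (S j) fun i => x ⟨j, i⟩

namespace PlanarAlgebra

variable {V : ℕ → Type*} [∀ n, AddCommGroup (V n)] [∀ n, Module ℂ (V n)] (P : PlanarAlgebra V)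

/-- The unit of the algebra `V n`. -/
def one (n : ℕ) : V n := P.act (Tangle.unit n) fun _ => 0

theorem update_pair {X : Type*} (x y z : X) :
    Function.update ![x, y] 0 z = ![z, y] ∧ Function.update ![x, y] 1 z = ![x, z] := by
  constructor <;> funext i <;> fin_cases i <;> rfl

/-- The product of the algebra `V n`, given by the multiplication tangle. -/
def mul (n : ℕ) : V n →ₗ[ℂ] V n →ₗ[ℂ] V n :=
  LinearMap.mk₂ ℂ (fun x y => P.act (Tangle.mul n) ![x, y])
    (fun x x' y => by
      have h := (P.act (Tangle.mul n)).map_update_add ![x, y] 0 x x'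
      rwa [(update_pair x y _).1, (update_pair x y _).1, (update_pair x y _).1] at h)
    (fun c x y => by
      have h := (P.act (Tangle.mul n)).map_update_smul ![x, y] 0 c x
      rwa [(update_pair x y _).1, (update_pair x y _).1] at h)
    (fun x y y' => by
      have h := (P.act (Tangle.mul n)).map_update_add ![x, y] 1 y y'
      rwa [(update_pair x y _).2, (update_pair x y _).2, (update_pair x y _).2] at h)
    (fun c x y => by
      have h := (P.act (Tangle.mul n)).map_update_smul ![x, y] 1 c y
      rwa [(update_pair x y _).2, (update_pair x y _).2] at h)

theorem update_single {X : Type*} (x z : X) :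
    Function.update (fun _ : Unit => x) () z = fun _ => z := by
  funext i; rfl

/-- The inclusion `V n → V (n + 1)`, given by the inclusion tangle. -/
def incl (n : ℕ) : V n →ₗ[ℂ] V (n + 1) where
  toFun x := P.act (Tangle.incl n) fun _ => x
  map_add' x y := by
    have h := (P.act (Tangle.incl n)).map_update_add (fun _ => x) () x y
    rwa [update_single, update_single, update_single] at h
  map_smul' c x := by
    have h := (P.act (Tangle.incl n)).map_update_smul (fun _ => x) () c x
    rwa [update_single, update_single] at h

end PlanarAlgebra

/-! ### Compact quantum groups of Kac type -/

section OperatorTensor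

theorem completion_add {E : Type*} [NormedAddCommGroup E] [NormedSpace ℂ E] (S T : E →L[ℂ] E) :
    (S + T).completion = S.completion + T.completion := by
  refine ContinuousLinearMap.ext fun x => ?_
  refine UniformSpace.Completion.induction_on x
    (isClosed_eq (ContinuousLinearMap.continuous _) (ContinuousLinearMap.continuous _)) fun x => ?_
  rw [add_apply]
  simp only [ContinuousLinearMap.completion_apply_coe, add_apply,
    UniformSpace.Completion.coe_add]

theorem completion_smul {E : Type*} [NormedAddCommGroup E] [NormedSpace ℂ E] (c : ℂ)
    (T : E →L[ℂ] E) : (c • T).completion = c • T.completion := by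
  refine ContinuousLinearMap.ext fun x => ?_
  refine UniformSpace.Completion.induction_on x
    (isClosed_eq (ContinuousLinearMap.continuous _) (ContinuousLinearMap.continuous _)) fun x => ?_
  rw [smul_apply]
  simp only [ContinuousLinearMap.completion_apply_coe, smul_apply,
    UniformSpace.Completion.coe_smul]

/-- The Hilbert space tensor product. -/
abbrev HilbertTensor (H K : Type*) [NormedAddCommGroup H] [InnerProductSpace ℂ H]
    [NormedAddCommGroup K] [InnerProductSpace ℂ K] : Type _ :=
  UniformSpace.Completion (H ⊗[ℂ] K)

/-- The operator `S ⊗ T` on the Hilbert space tensor product, bilinearly in `S` and `T`. -/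
noncomputable def operatorTensor {H K : Type*} [NormedAddCommGroup H] [InnerProductSpace ℂ H]
    [NormedAddCommGroup K] [InnerProductSpace ℂ K] :
    (H →L[ℂ] H) ⊗[ℂ] (K →L[ℂ] K) →ₗ[ℂ] (HilbertTensor H K →L[ℂ] HilbertTensor H K) :=
  TensorProduct.lift <| LinearMap.mk₂ ℂ (fun S T => (TensorProduct.mapL S T).completion)
    (fun S S' T => by rw [TensorProduct.mapL_add_left, completion_add])
    (fun c S T => by rw [TensorProduct.mapL_smul_left, completion_smul])
    (fun S T T' => by rw [TensorProduct.mapL_add_right, completion_add])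
    (fun c S T => by rw [TensorProduct.mapL_smul_right, completion_smul])

end OperatorTensor

/-- A unitary compact quantum group `G` of Kac type, with `Z = C(G)`.

The tensor product `Z ⊗ Z` is the spatial one, realized in a faithful representation
`rep` of `Z` on a Hilbert space `H`, as the closed span of the operators `rep a ⊗ rep b` on the
Hilbert space tensor product of `H` with itself. The choice of `rep` does not matter, and `comul`
takes its values in `Z ⊗ Z`, because the entries of `u` generate `Z`. -/
structure KacQuantumGroup (Z : Type*) [CStarAlgebra Z] (H : Type*) [NormedAddCommGroup H]
    [InnerProductSpace ℂ H] [CompleteSpace H] where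
  N : ℕ
  u : Matrix (Fin N) (Fin N) Z
  unitary : u ∈ unitary (Matrix (Fin N) (Fin N) Z)
  generates : (StarAlgebra.adjoin ℂ (Set.range fun p : Fin N × Fin N => u p.1 p.2)).topologicalClosure
    = ⊤
  rep : Z →⋆ₐ[ℂ] (H →L[ℂ] H)
  rep_injective : Function.Injective rep
  comul : Z →⋆ₐ[ℂ] (HilbertTensor H H →L[ℂ] HilbertTensor H H)
  comul_u : ∀ i j, comul (u i j) = ∑ k, operatorTensor (rep (u i k) ⊗ₜ rep (u k j))
  counit : Z →⋆ₐ[ℂ] ℂ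
  counit_u : ∀ i j, counit (u i j) = if i = j then 1 else 0
  antipode : Z →⋆ₐ[ℂ] Zᵐᵒᵖ
  antipode_u : ∀ i j, antipode (u i j) = MulOpposite.op (star (u j i))

namespace KacQuantumGroup

variable {Z : Type*} [CStarAlgebra Z] {H : Type*} [NormedAddCommGroup H] [InnerProductSpace ℂ H]
  [CompleteSpace H] (G : KacQuantumGroup Z H)

/-- `C^∞(G)`, the dense `*`-subalgebra of `C(G)` generated by the entries of `u`. -/
noncomputable def smooth : StarSubalgebra ℂ Z :=
  StarAlgebra.adjoin ℂ (Set.range fun p : Fin G.N × Fin G.N => G.u p.1 p.2)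

/-- The inclusion of the algebraic tensor product of `C(G)` with itself into `C(G) ⊗ C(G)`. -/
noncomputable def tensorRep : Z ⊗[ℂ] Z →ₗ[ℂ] (HilbertTensor H H →L[ℂ] HilbertTensor H H) :=
  operatorTensor ∘ₗ TensorProduct.map (G.rep : Z →ₗ[ℂ] (H →L[ℂ] H)) (G.rep : Z →ₗ[ℂ] (H →L[ℂ] H))

variable [PartialOrder Z] [StarOrderedRing Z]

/-- `φ` is the Haar state: `(id ⊗ φ) Δ(z) = φ(z) 1 = (φ ⊗ id) Δ(z)`. It suffices to have this on
the dense set of those `z` for which `Δ(z)` is in the algebraic tensor product. -/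
def IsHaar (φ : Z →ₚ[ℂ] ℂ) : Prop :=
  φ 1 = 1 ∧ ∀ (z : Z) (t : Z ⊗[ℂ] Z), G.comul z = G.tensorRep t →
    TensorProduct.rid ℂ Z (TensorProduct.map LinearMap.id (φ : Z →ₗ[ℂ] ℂ) t) = φ z • (1 : Z) ∧
    TensorProduct.lid ℂ Z (TensorProduct.map (φ : Z →ₗ[ℂ] ℂ) LinearMap.id t) = φ z • (1 : Z)

open Classical in
/-- The Haar state of `G` (which exists, and is unique, by a theorem of Woronowicz). -/
noncomputable def haar : Z →ₚ[ℂ] ℂ := if h : ∃ φ, G.IsHaar φ then h.choose else 0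

/-- The von Neumann algebra `L^∞(G)`: the bicommutant of the image of `C(G)` in the GNS
representation of the Haar state. -/
noncomputable def vonNeumann : VonNeumannAlgebra G.haar.GNS where
  toStarSubalgebra := StarSubalgebra.centralizer ℂ
    (StarSubalgebra.centralizer ℂ (Set.range G.haar.gnsStarAlgHom) : Set (G.haar.GNS →L[ℂ] G.haar.GNS))
  centralizer_centralizer' := by
    simp

/-- `L^∞(G)`, as an algebra. -/
abbrev LInfty : Type _ := G.vonNeumann.toStarSubalgebra

/-- The canonical map `C(G) → L^∞(G)`. -/
noncomputable def toLInfty : Z →⋆ₐ[ℂ] G.LInfty :=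
  G.haar.gnsStarAlgHom.codRestrict _ fun z =>
    (StarSubalgebra.mem_centralizer_iff ℂ).2 fun _ hg =>
      ⟨((StarSubalgebra.mem_centralizer_iff ℂ).1 hg _ ⟨z, rfl⟩).1.symm,
        ((StarSubalgebra.mem_centralizer_iff ℂ).1 (star_mem hg) _ ⟨z, rfl⟩).1.symm⟩

end KacQuantumGroup

/-! ### Coactions -/

section Coaction

variable {Z : Type*} [CStarAlgebra Z] {H : Type*} [NormedAddCommGroup H] [InnerProductSpace ℂ H]
  [CompleteSpace H] [PartialOrder Z] [StarOrderedRing Z]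
  {V : ℕ → Type*} [∀ n, AddCommGroup (V n)] [∀ n, Module ℂ (V n)]

/-- A coaction of `L^∞(G)` on the graded algebra `V = (V n)` underlying a planar algebra with
finite dimensional `V n`, that is, on each of the algebras `V n`, in a way which is compatible
with the inclusions `V n → V (n + 1)`. As `V n` is finite dimensional, the tensor product
`L^∞(G) ⊗ V n` is the algebraic one. A planar algebra carries neither an involution nor a trace;
if the `V n` happen to be C*-algebras with traces, coactions which preserve these are included. -/
structure GradedCoaction (G : KacQuantumGroup Z H) (P : PlanarAlgebra V) where
  /-- the coaction on `V n` -/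
  map : ∀ n, V n →ₗ[ℂ] G.LInfty ⊗[ℂ] V n
  injective : ∀ n, Function.Injective (map n)
  map_one : ∀ n, map n (P.one n) = 1 ⊗ₜ P.one n
  map_mul : ∀ n x y, map n (P.mul n x y) =
    TensorProduct.map₂ (LinearMap.mul ℂ G.LInfty) (P.mul n) (map n x) (map n y)
  /-- the coaction restricted to `C^∞(G)` -/
  smoothMap : ∀ n, V n →ₗ[ℂ] G.smooth ⊗[ℂ] V n
  /-- the smooth part of `V n` is dense, and so it is `V n` itself: the coaction takes its values
  in the image of `C^∞(G) ⊗ V n` -/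
  map_eq : ∀ n x, map n x = TensorProduct.map
    ((G.toLInfty : Z →ₗ[ℂ] G.LInfty) ∘ₗ G.smooth.subtype.toLinearMap) LinearMap.id (smoothMap n x)
  /-- coassociativity, `(Δ ⊗ id) α = (id ⊗ α) α` -/
  coassoc : ∀ n x, TensorProduct.map
      ((G.comul : Z →ₗ[ℂ] _) ∘ₗ G.smooth.subtype.toLinearMap) LinearMap.id (smoothMap n x) =
    TensorProduct.map (G.tensorRep ∘ₗ TensorProduct.map
        G.smooth.subtype.toLinearMap G.smooth.subtype.toLinearMap) LinearMap.id
      ((TensorProduct.assoc ℂ G.smooth G.smooth (V n)).symm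
        (TensorProduct.map LinearMap.id (smoothMap n) (smoothMap n x)))
  map_incl : ∀ n x, map (n + 1) (P.incl n x) =
    TensorProduct.map LinearMap.id (P.incl n) (map n x)

/-- The space of fixed points of the coaction on `V n`. -/
def GradedCoaction.fixedPoints {G : KacQuantumGroup Z H} {P : PlanarAlgebra V}
    (α : GradedCoaction G P) (n : ℕ) : Submodule ℂ (V n) where
  carrier := {x | α.map n x = 1 ⊗ₜ x}
  add_mem' {x y} hx hy := by
    simp only [Set.mem_ofPred_eq] at hx hy ⊢
    rw [_root_.map_add, hx, hy, TensorProduct.tmul_add]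
  zero_mem' := by simp
  smul_mem' c x hx := by
    simp only [Set.mem_ofPred_eq] at hx ⊢
    rw [map_smul, hx, TensorProduct.tmul_smul]

/-- A coaction of `L^∞(G)` on a planar algebra: a graded algebra coaction such that the annular
tangles, which are the tangles having at most one input box, are weakly `G`-equivariant, in the
sense that they send fixed points to fixed points. -/
structure PlanarCoaction (G : KacQuantumGroup Z H) (P : PlanarAlgebra V) extends
    GradedCoaction G P where
  weakly_equivariant : ∀ {ι : Type} [Subsingleton ι] {k : ι → ℕ} {n : ℕ} (T : Tangle k n)
    (x : ∀ j, V (k j)), (∀ j, x j ∈ toGradedCoaction.fixedPoints (k j)) →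
    P.act T x ∈ toGradedCoaction.fixedPoints n

end Coaction

/-! Fixed points are stable under annular tangles, by assumption, and under products, since a
coaction is multiplicative and (1 ⊗ x)(1 ⊗ y) = 1 ⊗ xy. So it suffices that every tangle is, up to
isotopy, obtained from tangles with fewer boxes by products and annular tangles;
`act_mem_fixedPoints` is an induction on the number of boxes.

Cut a tangle with at least two boxes along a horizontal line below its topmost box: an upper picture
`u` from `n` to `m` strands and a lower picture `v` from `m` to `n`. These are tangles only if `m =
n`, but `m` and `n` have the same parity (`Runs.mod_two`), and bending strands makes both pictures
square. If `n = m + 2 * t`, bend the last `t` upper strands of `u` down and the last `t` lower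
strands of `v` up. This gives two `(m + t)`-boxes. With `t` strings added at right, the tangle is
the product of three `n`-boxes: bent `u`, then `t` nested minima above `t` nested maxima, then bent
`v`. If `m = n + 2 * t`, bend the last `t` lower strands of `u` up and the last `t` upper strands of
`v` down. The product of the two padded pictures is an `m`-box, and an annular tangle closing its
last `2 * t` points on each side by nested arcs gives back the tangle.

All bending takes place at the right, so the parity rule at the left of the boxes is undisturbed.
The isotopies are `bend_top` and `bend_bottom`; they need only exchanges of heights and
straightenings of zigzags. -/

namespace Planar

/-! ### Pictures with arbitrary numbers of strands on top and at the bottom -/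

section Pictures

variable {ι κ μ : Type*} {k : ι → ℕ}

theorem Piece.map_map (f : κ → μ) (g : ι → κ) (p : Piece ι) :
    (p.map g).map f = p.map (f ∘ g) := by cases p <;> rfl

theorem Layer.shift_shift (a b : ℕ) (f : κ → μ) (g : ι → κ) (L : Layer ι) :
    (L.shift b g).shift a f = L.shift (a + b) (f ∘ g) := by
  simp [Layer.shift, Piece.map_map, add_assoc]

theorem Layer.shift_zero_id (L : Layer ι) : L.shift 0 _root_.id = L := by
  obtain ⟨a, p⟩ := L
  cases p <;> simp [Layer.shift, Piece.map]

theorem map_shift_zero_id (w : List (Layer ι)) : w.map (Layer.shift 0 _root_.id) = w := by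
  rw [funext Layer.shift_zero_id]
  simp

theorem labels_append (u v : List (Layer ι)) : labels (u ++ v) = labels u ++ labels v :=
  List.filterMap_append

theorem Runs.split {u v : List (Layer ι)} {n m : ℕ} (h : Runs k n (u ++ v) m) :
    ∃ r, Runs k n u r ∧ Runs k r v m := by
  induction u generalizing n with
  | nil => exact ⟨n, rfl, h⟩
  | cons L u ih =>
    obtain ⟨r, h1, h2⟩ := ih h.2.2
    exact ⟨r, ⟨h.1, h.2.1, h1⟩, h2⟩

/-- Strings can be added at the right of a picture. -/
theorem Runs.add_right {w : List (Layer ι)} {n m : ℕ} (h : Runs k n w m) (b : ℕ) :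
    Runs k (n + b) w (m + b) := by
  have := h.shift (k := k) _root_.id (a := 0) (by simp) b
  rwa [map_shift_zero_id, zero_add, zero_add] at this

/-- Strings can be added at the left of a picture without boxes. -/
theorem Runs.add_left {w : List (Layer ι)} {n m : ℕ} (h : Runs k n w m) (hw : labels w = [])
    (a : ℕ) : Runs k (a + n) (w.map (Layer.shift a _root_.id)) (a + m) := by
  induction w generalizing n with
  | nil => cases h; rfl
  | cons L w ih =>
    obtain ⟨l, p⟩ := L
    obtain ⟨h1, -, h3⟩ := h
    have h4 := ih h3
    cases p with
    | box j => simp [labels, Piece.label] at hw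
    | maximum =>
      refine ⟨?_, nofun, ?_⟩
      · simp only [Layer.shift, Piece.map, Piece.top] at h1 ⊢; omega
      · exact h4 (by simpa [labels, Piece.label] using hw)
    | minimum =>
      simp only [Piece.top, Piece.bot] at h1 h4
      refine ⟨?_, nofun, ?_⟩
      · simp only [Layer.shift, Piece.map, Piece.top]; omega
      · have := h4 (by simpa [labels, Piece.label] using hw)
        simp only [Layer.shift, Piece.map, Piece.top, Piece.bot]
        rwa [show a + n - 2 + 0 = a + (n - 2 + 0) by omega]

/-- A box preserves the number of strands, and an extremum changes it by two. This makes the defect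
of a cut picture from being square an even number `2 * t`. -/
theorem Runs.mod_two {w : List (Layer ι)} {n m : ℕ} (h : Runs k n w m) : n % 2 = m % 2 := by
  induction w generalizing n with
  | nil => cases h; rfl
  | cons L w ih =>
    obtain ⟨h1, -, h3⟩ := h
    have h4 := ih h3
    obtain ⟨l, p⟩ := L
    cases p <;> simp only [Piece.top, Piece.bot] at h1 h4 <;> omega

theorem Runs.of_map {k : κ → ℕ} (f : ι → κ) {w : List (Layer ι)} {n m : ℕ}
    (h : Runs k n (w.map (Layer.shift 0 f)) m) : Runs (k ∘ f) n w m := by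
  induction w generalizing n with
  | nil => exact h
  | cons L w ih =>
    obtain ⟨h1, h2, h3⟩ := h
    simp only [Layer.shift, Piece.top_map, Piece.bot_map, zero_add] at h1 h2 h3
    refine ⟨h1, fun j hj => h2 (f j) ?_, ih h3⟩
    rw [hj]; rfl

theorem nestedMaxima_succ (a m : ℕ) :
    nestedMaxima (ι := ι) a (m + 1) = ⟨a, Piece.maximum⟩ :: nestedMaxima (a + 1) m := by
  simp only [nestedMaxima, List.range_succ_eq_map, List.map_cons, List.map_map]
  simp [Function.comp_def, add_assoc, add_comm 1]

theorem nestedMinima_succ (a m : ℕ) :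
    nestedMinima (ι := ι) a (m + 1) = ⟨a + m, Piece.minimum⟩ :: nestedMinima a m := by
  simp [nestedMinima, List.range_succ]

theorem map_nestedMaxima (f : ι → κ) (b a m : ℕ) :
    (nestedMaxima a m).map (Layer.shift b f) = nestedMaxima (b + a) m := by
  simp [nestedMaxima, Layer.shift, Piece.map, Function.comp_def, add_assoc]

theorem map_nestedMinima (f : ι → κ) (b a m : ℕ) :
    (nestedMinima a m).map (Layer.shift b f) = nestedMinima (b + a) m := by
  simp [nestedMinima, Layer.shift, Piece.map, Function.comp_def, add_assoc]

@[simp] theorem labels_nestedMaxima (a m : ℕ) : labels (nestedMaxima (ι := ι) a m) = [] := by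
  simp [labels, nestedMaxima, Piece.label]

@[simp] theorem labels_nestedMinima (a m : ℕ) : labels (nestedMinima (ι := ι) a m) = [] := by
  simp [labels, nestedMinima, Piece.label]

theorem runs_nestedMaxima {n a m r : ℕ} (h : a ≤ n) (hr : r = n + 2 * m) :
    Runs k n (nestedMaxima a m) r := by
  induction m generalizing n a with
  | zero => simpa [nestedMaxima, Runs] using hr.symm
  | succ m ih =>
    rw [nestedMaxima_succ]
    exact ⟨h, nofun, ih (by simp only [Piece.top, Piece.bot]; omega)
      (by simp only [Piece.top, Piece.bot]; omega)⟩

theorem runs_nestedMinima {n a m r : ℕ} (h : a ≤ r) (hr : n = r + 2 * m) :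
    Runs k n (nestedMinima a m) r := by
  induction m generalizing n with
  | zero => simpa [nestedMinima, Runs] using hr
  | succ m ih =>
    rw [nestedMinima_succ]
    exact ⟨by simp only [Piece.top]; omega, nofun, ih (by simp only [Piece.top, Piece.bot]; omega)⟩

/-! ### Isotopy of pictures: sliding, straightening, bending -/

/-- An elementary isotopy between pictures with `n` strands on top and `m` at the bottom. -/
def PictureStep (k : ι → ℕ) (n m : ℕ) (w w' : List (Layer ι)) : Prop :=
  Runs k n w m ∧ Runs k n w' m ∧
    ∃ u v s s', Move k s s' ∧ w = u ++ s ++ v ∧ w' = u ++ s' ++ v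

/-- Planar isotopy of pictures with `n` strands on top and `m` at the bottom. -/
def PictureIsotopic (k : ι → ℕ) (n m : ℕ) : List (Layer ι) → List (Layer ι) → Prop :=
  Relation.EqvGen (PictureStep k n m)

namespace PictureIsotopic

theorem refl {n m : ℕ} (w : List (Layer ι)) : PictureIsotopic k n m w w := Relation.EqvGen.refl _

theorem symm {n m : ℕ} {w w' : List (Layer ι)} (h : PictureIsotopic k n m w w') :
    PictureIsotopic k n m w' w := Relation.EqvGen.symm _ _ h

theorem trans {n m : ℕ} {w w' w'' : List (Layer ι)} (h : PictureIsotopic k n m w w')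
    (h' : PictureIsotopic k n m w' w'') : PictureIsotopic k n m w w'' :=
  Relation.EqvGen.trans _ _ _ h h'

theorem of_move {n m : ℕ} {w w' : List (Layer ι)} (h : Move k w w') (hw : Runs k n w m)
    (hw' : Runs k n w' m) : PictureIsotopic k n m w w' :=
  .rel _ _ ⟨hw, hw', [], [], w, w', h, by simp, by simp⟩

theorem append {n m n' m' : ℕ} {u v w w' : List (Layer ι)} (hu : Runs k n' u n)
    (h : PictureIsotopic k n m w w') (hv : Runs k m v m') :
    PictureIsotopic k n' m' (u ++ w ++ v) (u ++ w' ++ v) := by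
  induction h with
  | rel w w' h =>
    obtain ⟨h1, h2, u', v', s, s', h3, rfl, rfl⟩ := h
    exact .rel _ _ ⟨(hu.append h1).append hv, (hu.append h2).append hv, u ++ u', v' ++ v, s, s', h3,
      by simp, by simp⟩
  | refl w => exact .refl _
  | symm _ _ _ ih => exact ih.symm
  | trans _ _ _ _ _ ih ih' => exact ih.trans ih'

theorem append_left {n m n' : ℕ} {u w w' : List (Layer ι)} (hu : Runs k n' u n)
    (h : PictureIsotopic k n m w w') : PictureIsotopic k n' m (u ++ w) (u ++ w') := by
  simpa using h.append (v := []) hu rfl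

theorem append_right {n m m' : ℕ} {v w w' : List (Layer ι)}
    (h : PictureIsotopic k n m w w') (hv : Runs k m v m') :
    PictureIsotopic k n m' (w ++ v) (w' ++ v) := by
  simpa using h.append (u := []) rfl hv

/-- A layer without box slides past a picture on its left. -/
theorem slide_layer {w : List (Layer ι)} {n m : ℕ} (hw : Runs k n w m) (q : Piece ι)
    (hq : q.label = none) (c d : ℕ) :
    PictureIsotopic k (n + (c + q.top k + d)) (m + (c + q.bot k + d))
      (w ++ [⟨m + c, q⟩]) (⟨n + c, q⟩ :: w) := by
  have hq' : ∀ j, q ≠ Piece.box j := by rintro j rfl; cases hq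
  induction w generalizing n with
  | nil => cases hw; exact .refl _
  | cons L w ih =>
    obtain ⟨a, p⟩ := L
    obtain ⟨h1, h2, h3⟩ := hw
    simp only at h1 h2 h3
    set r := n - p.top k + p.bot k with hr
    have e1 : PictureIsotopic k (n + (c + q.top k + d)) (m + (c + q.bot k + d))
        (⟨a, p⟩ :: (w ++ [⟨m + c, q⟩])) (⟨a, p⟩ :: ⟨r + c, q⟩ :: w) := by
      refine append_left (n := r + (c + q.top k + d)) (u := [⟨a, p⟩]) ⟨?_, h2, ?_⟩ (ih h3)
      · simp only; omega
      · simp only [Runs]; omega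
    refine e1.trans ?_
    refine append_right (m := r + (c + q.bot k + d)) (w := [⟨a, p⟩, ⟨r + c, q⟩])
      (w' := [⟨n + c, q⟩, ⟨a, p⟩]) ?_ (h3.add_right _)
    refine of_move ?_ ⟨by simp only; omega, h2, ?_, fun j hj => absurd hj (hq' j), ?_⟩
      ⟨?_, fun j hj => absurd hj (hq' j), ?_, h2, ?_⟩
    -- Between the two pieces lie the strands of the head layer not entering `p`, and then `c` more;
    -- `n - p.top k + c` counts these together with the `a` strands on the left of `p`.
    · have := Move.exchange (k := k) a (n - p.top k + c) p q (by omega)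
      rwa [show n - p.top k + c + p.bot k = r + c by omega,
        show n - p.top k + c + p.top k = n + c by omega] at this
    all_goals simp only [Runs]; omega

/-- A picture without boxes slides past a picture on its left. -/
theorem slide {w v : List (Layer ι)} {n m p q : ℕ} (hw : Runs k n w m) (hv : Runs k p v q)
    (hl : labels v = []) :
    PictureIsotopic k (n + p) (m + q) (w ++ v.map (Layer.shift m _root_.id))
      (v.map (Layer.shift n _root_.id) ++ w) := by
  induction v generalizing p with
  | nil => simpa using refl _
  | cons L v ih =>
    obtain ⟨c, s⟩ := L
    have hs : s.label = none := by
      by_contra h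
      obtain ⟨j, hj⟩ := Option.ne_none_iff_exists'.1 h
      simp [labels, hj] at hl
    have hl' : labels v = [] := by simpa [labels, hs] using hl
    obtain ⟨h1, h2, h3⟩ := hv
    simp only at h1 h3
    have hsm : s.map _root_.id = s := by cases s <;> rfl
    have e := slide_layer hw s hs c (p - (c + s.top k))
    rw [show c + s.top k + (p - (c + s.top k)) = p by omega,
      show c + s.bot k + (p - (c + s.top k)) = p - s.top k + s.bot k by omega] at e
    have e1 := e.append_right (h3.add_left hl' m)
    have hn : Runs k (n + p) [⟨n + c, s⟩] (n + (p - s.top k + s.bot k)) :=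
      ⟨by simp only; omega, fun j (hj : s = .box j) => (by subst hj; cases hs),
        by simp only [Runs]; omega⟩
    have e2 := (ih h3 hl').append_left hn
    simpa [Layer.shift, hsm] using e1.trans (by simpa using e2)

theorem nested_zigzag {n a : ℕ} (t : ℕ) (h : a + t ≤ n) :
    PictureIsotopic k n n (nestedMaxima a t ++ nestedMinima (a + t) t) [] := by
  induction t generalizing a with
  | zero => exact .refl _
  | succ t ih =>
    -- The innermost minimum lies on the right of the `t` inner maxima. Slid above them, it meets
    -- the outermost maximum and forms a single zigzag with it; the remaining arcs are the case `t`.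
    have e := slide (k := k) (w := nestedMaxima (a + 1) t) (v := [⟨0, Piece.minimum⟩])
      (n := a + 1) (m := a + 1 + 2 * t) (p := n + 1 - a) (q := n - 1 - a)
      (runs_nestedMaxima le_rfl rfl)
      ⟨by simp only [Piece.top]; omega, nofun, by simp only [Runs, Piece.top, Piece.bot]; omega⟩ rfl
    have e1 := e.append (u := [⟨a, Piece.maximum⟩]) (v := nestedMinima (a + (t + 1)) t)
      (n' := n) (m' := n)
      ⟨by simp only [Piece.top]; omega, nofun, by simp only [Runs, Piece.top, Piece.bot]; omega⟩
      (runs_nestedMinima (by omega) (by omega))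
    have e2 := (of_move (n := n) (m := n) (Move.zigzag (k := k) a)
      ⟨by simp only [Piece.top]; omega, nofun, by simp only [Piece.top, Piece.bot]; omega, nofun,
        by simp only [Runs, Piece.top, Piece.bot]; omega⟩ rfl).append_right
      (v := nestedMaxima (a + 1) t ++ nestedMinima (a + 1 + t) t) (m' := n)
      ((runs_nestedMaxima (by omega) rfl).append (runs_nestedMinima (by omega) rfl))
    have e3 := e2.trans (ih (a := a + 1) (by omega))
    rw [nestedMaxima_succ, nestedMinima_succ]
    simp only [List.map_cons, List.map_nil, Layer.shift, Piece.map, add_zero, List.append_assoc,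
      List.cons_append, List.nil_append] at e1 e3 ⊢
    rw [show a + (t + 1) + t = a + 1 + 2 * t by omega]
    refine e1.trans ?_
    rwa [show a + (t + 1) = a + 1 + t by omega]

theorem nested_zagzig {n a : ℕ} (t : ℕ) (h : a + t ≤ n) :
    PictureIsotopic k n n (nestedMaxima (a + t) t ++ nestedMinima a t) [] := by
  induction t with
  | zero => exact .refl _
  | succ t ih =>
    -- Mirror situation: the innermost minimum lies on the left of the `t` inner maxima, which slide
    -- below it and leave it just under the outermost maximum.
    have e := slide (k := k) (w := [⟨a + t, Piece.minimum⟩]) (v := nestedMaxima 0 t)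
      (n := a + t + 2) (m := a + t) (p := n - a - t) (q := n - a - t + 2 * t)
      ⟨by simp only [Piece.top]; omega, nofun, by simp only [Runs, Piece.top, Piece.bot]; omega⟩
      (runs_nestedMaxima (by omega) rfl) (by simp)
    have e1 := e.symm.append (u := [⟨a + t + 1, Piece.maximum⟩]) (v := nestedMinima a t)
      (n' := n) (m' := n)
      ⟨by simp only [Piece.top]; omega, nofun, by simp only [Runs, Piece.top, Piece.bot]; omega⟩
      (runs_nestedMinima (by omega) (by omega))
    have e2 := (of_move (n := n) (m := n) (Move.zagzig (k := k) (a + t))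
      ⟨by simp only [Piece.top]; omega, nofun, by simp only [Piece.top, Piece.bot]; omega, nofun,
        by simp only [Runs, Piece.top, Piece.bot]; omega⟩ rfl).append_right
      (v := nestedMaxima (a + t) t ++ nestedMinima a t) (m' := n)
      ((runs_nestedMaxima (by omega) rfl).append (runs_nestedMinima (by omega) rfl))
    have e3 := e2.trans (ih (by omega))
    rw [nestedMaxima_succ, nestedMinima_succ]
    simp only [map_nestedMaxima, add_zero, List.append_assoc,
      List.cons_append, List.nil_append] at e1 e3 ⊢
    exact e1.trans e3

/-- The last `t` strands on top of a picture are bent down along its right side, and back. -/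
theorem bend_top {w : List (Layer ι)} {n m t : ℕ} (hw : Runs k n w m) (ht : t ≤ n) :
    PictureIsotopic k n m (nestedMaxima (n - t) t ++ (w ++ nestedMinima m t)) w := by
  -- The minima move up along the right side of `w` until they meet the maxima above it.
  have e := slide hw (runs_nestedMinima (n := 0 + 2 * t) (a := 0) (r := 0) le_rfl rfl) (by simp)
  simp only [map_nestedMinima, add_zero, zero_add] at e
  have e1 := e.append_left (runs_nestedMaxima (n := n) (a := n - t) (m := t) (by omega) rfl)
  have e2 := (nested_zigzag (k := k) (n := n) (a := n - t) t (by omega)).append_right hw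
  rw [show n - t + t = n by omega] at e2
  exact e1.trans (by simpa using e2)

/-- The last `t` strands at the bottom of a picture are bent up along its right side, and back. -/
theorem bend_bottom {w : List (Layer ι)} {n m t : ℕ} (hw : Runs k n w m) (ht : t ≤ m) :
    PictureIsotopic k n m (nestedMaxima n t ++ (w ++ nestedMinima (m - t) t)) w := by
  -- Here the maxima move down along the right side of `w` and meet the minima below it.
  have e := slide hw (runs_nestedMaxima (n := 0) (a := 0) (m := t) le_rfl rfl) (by simp)
  simp only [map_nestedMaxima, add_zero, zero_add] at e
  have e1 := e.symm.append_right (v := nestedMinima (m - t) t) (m' := m)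
    (runs_nestedMinima (by omega) rfl)
  have e2 := (nested_zagzig (k := k) (n := m) (a := m - t) t (by omega)).append_left hw
  rw [show m - t + t = m by omega] at e2
  simp only [List.append_assoc, List.append_nil] at e1 e2
  exact e1.trans e2

end PictureIsotopic

/-! ### From pictures back to tangles -/

theorem Move.labels_perm {w w' : List (Layer ι)} (h : Move k w w') :
    (labels w).Perm (labels w') := by
  cases h with
  | exchange a c p q h =>
    rw [labels, labels]
    exact (List.Perm.swap _ _ _).filterMap _
  | zigzag a => exact .refl _
  | zagzig a => exact .refl _
  | rotate a j =>
    simp only [labels_append, labels_nestedMaxima, labels_nestedMinima]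
    exact .refl _

/-- Moves only permute the labels, so a square picture isotopic to a tangle is itself a tangle. The
two claims are proved together because transitivity needs the intermediate picture to be a tangle.
-/
theorem PictureIsotopic.exists_tangle {n : ℕ} {w w' : List (Layer ι)}
    (h : PictureIsotopic k n n w w') :
    ((∃ T : Tangle k n, T.layers = w) ↔ ∃ T : Tangle k n, T.layers = w') ∧
      ∀ T T' : Tangle k n, T.layers = w → T'.layers = w' → T.Isotopic T' := by
  induction h with
  | rel w w' h =>
    obtain ⟨h1, h2, u, v, s, s', h3, rfl, rfl⟩ := h
    have hp : (labels (u ++ s ++ v)).Perm (labels (u ++ s' ++ v)) := by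
      simp only [labels_append]
      exact (h3.labels_perm.append_left _).append_right _
    refine ⟨⟨?_, ?_⟩, fun T T' hT hT' => .rel _ _ ⟨u, v, s, s', h3, hT, hT'⟩⟩
    · rintro ⟨T, hT⟩
      exact ⟨⟨_, h2, hp.nodup_iff.1 (hT ▸ T.nodup), fun j => hp.mem_iff.1 (hT ▸ T.mem_labels j)⟩, rfl⟩
    · rintro ⟨T, hT⟩
      exact ⟨⟨_, h1, hp.nodup_iff.2 (hT ▸ T.nodup), fun j => hp.mem_iff.2 (hT ▸ T.mem_labels j)⟩, rfl⟩
  | refl w =>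
    refine ⟨Iff.rfl, fun T T' hT hT' => ?_⟩
    obtain rfl : T = T' := by
      cases T; cases T'; subst hT; cases hT'; rfl
    exact .refl _
  | symm _ _ _ ih => exact ⟨ih.1.symm, fun T T' hT hT' => .symm _ _ (ih.2 T' T hT' hT)⟩
  | trans _ _ _ _ _ ih ih' =>
    refine ⟨ih.1.trans ih'.1, fun T T' hT hT' => ?_⟩
    obtain ⟨T'', hT''⟩ := ih.1.1 ⟨T, hT⟩
    exact .trans _ _ _ (ih.2 _ _ hT hT'') (ih'.2 _ _ hT'' hT')

theorem exists_map_val (s : ι → Prop) (w : List (Layer ι)) (h : ∀ j ∈ labels w, s j) :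
    ∃ w' : List (Layer {j // s j}), w'.map (Layer.shift 0 Subtype.val) = w := by
  induction w with
  | nil => exact ⟨[], rfl⟩
  | cons L w ih =>
    obtain ⟨a, p⟩ := L
    obtain ⟨w', hw'⟩ := ih fun j hj => h j <| by
      rw [← List.singleton_append, labels_append]
      exact List.mem_append_right _ hj
    cases p with
    | maximum => exact ⟨⟨a, .maximum⟩ :: w', by simp [Layer.shift, Piece.map, hw']⟩
    | minimum => exact ⟨⟨a, .minimum⟩ :: w', by simp [Layer.shift, Piece.map, hw']⟩
    | box j =>
      exact ⟨⟨a, .box ⟨j, h j (by simp [labels, Piece.label])⟩⟩ :: w',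
        by simp [Layer.shift, Piece.map, hw']⟩

/-- A picture in which no box occurs twice is a tangle with boxes labelled by a subset. -/
theorem exists_tangle_map_val {w : List (Layer ι)} {n : ℕ} (h : Runs k n w n)
    (hw : (labels w).Nodup) :
    ∃ T : Tangle (k ∘ (Subtype.val : {j // j ∈ labels w} → ι)) n,
      T.layers.map (Layer.shift 0 Subtype.val) = w := by
  obtain ⟨w', hw'⟩ := exists_map_val (· ∈ labels w) w fun _ hj => hj
  have hl : (labels w').map Subtype.val = labels w := by rw [← labels_shift Subtype.val 0, hw']
  refine ⟨⟨w', .of_map _ (by rwa [hw']), .of_map Subtype.val (by rwa [hl]), fun j => ?_⟩, hw'⟩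
  obtain ⟨i, hi, e⟩ := List.mem_map.1 (hl.symm ▸ j.2 : j.1 ∈ (labels w').map Subtype.val)
  rwa [Subtype.ext e] at hi

/-- The cut is made immediately below the topmost box. -/
theorem exists_split {w : List (Layer ι)} (h : 2 ≤ (labels w).length) :
    ∃ u v, w = u ++ v ∧ labels u ≠ [] ∧ labels v ≠ [] := by
  induction w with
  | nil => simp [labels] at h
  | cons L w ih =>
    have hL : labels (L :: w) = labels [L] ++ labels w := by
      rw [← labels_append, List.singleton_append]
    cases hl : L.piece.label with
    | none =>
      rw [hL] at h
      obtain ⟨u, v, rfl, hu, hv⟩ := ih (by simpa [labels, hl] using h)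
      exact ⟨L :: u, v, rfl, by simpa [labels, hl] using hu, hv⟩
    | some j =>
      refine ⟨[L], w, rfl, by simp [labels, hl], fun hw => ?_⟩
      rw [hL, hw] at h
      simp [labels, hl] at h

theorem Tangle.two_le_length_labels [Nontrivial ι] {n : ℕ} (T : Tangle k n) :
    2 ≤ (labels T.layers).length := by
  obtain ⟨i, j, hij⟩ := exists_pair_ne ι
  have hi := T.mem_labels i
  have hj := T.mem_labels j
  match labels T.layers, hi, hj with
  | [l], hi, hj => exact absurd ((List.mem_singleton.1 hi).trans (List.mem_singleton.1 hj).symm) hij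
  | _ :: _ :: _, _, _ => simp

/-! ### Substitution of pictures with a common set of labels -/

/-- Pictures with common labels are put into the boxes of a picture. -/
def substitute (w : ι → List (Layer κ)) : Layer ι → List (Layer κ)
  | ⟨a, Piece.maximum⟩ => [⟨a, Piece.maximum⟩]
  | ⟨a, Piece.minimum⟩ => [⟨a, Piece.minimum⟩]
  | ⟨a, Piece.box j⟩ => (w j).map (Layer.shift a _root_.id)

/-- Gluing labels the boxes by pairs. After projection to the original labels it becomes
`substitute`, so that, for instance, a product is a plain concatenation of lists. -/
theorem map_fill {κ : ι → Type*} (S : ∀ j, List (Layer (κ j))) (f : ∀ j, κ j → μ) (L : Layer ι) :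
    (Tangle.fill S L).map (Layer.shift 0 fun p => f p.1 p.2) =
      substitute (fun j => (S j).map (Layer.shift 0 (f j))) L := by
  obtain ⟨a, p⟩ := L
  cases p with
  | maximum => simp [Tangle.fill, substitute, Layer.shift, Piece.map]
  | minimum => simp [Tangle.fill, substitute, Layer.shift, Piece.map]
  | box j =>
    simp only [Tangle.fill, substitute, List.map_map]
    refine List.map_congr_left fun L _ => ?_
    simp only [Function.comp_apply, Layer.shift_shift]
    rw [add_comm]; rfl

theorem flatMap_substitute_nestedMaxima (w : ι → List (Layer κ)) (a t : ℕ) :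
    (nestedMaxima a t).flatMap (substitute w) = nestedMaxima a t := by
  rw [nestedMaxima, List.flatMap_map]
  exact List.map_eq_flatMap.symm

theorem flatMap_substitute_nestedMinima (w : ι → List (Layer κ)) (a t : ℕ) :
    (nestedMinima a t).flatMap (substitute w) = nestedMinima a t := by
  rw [nestedMinima, List.flatMap_map]
  exact List.map_eq_flatMap.symm

end Pictures

/-- An `m`-box inside an `n`-box, its last `t` points on each side being joined
to each other around its right side, and strings added at right. -/
def Tangle.annular (n m t : ℕ) (h : m ≤ n + 2 * t) : Tangle (fun _ : Unit => m) n where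
  -- The box takes the first `m` of `n + 2 * t` strands. The two cases of use are `t = 0`, which
  -- only adds `n - m` strings, and `m = n + 2 * t`, where the arcs join the last `2 * t` upper
  -- points of the box among themselves, and likewise the lower ones.
  layers := nestedMaxima n t ++ [⟨0, Piece.box ()⟩] ++ nestedMinima n t
  runs := by
    have hb : Runs (fun _ : Unit => m) (n + 2 * t) [⟨0, Piece.box ()⟩] (n + 2 * t) :=
      ⟨by simpa [Piece.top] using h, fun _ _ => by simp, by simp only [Runs, Piece.top, Piece.bot]; omega⟩
    exact ((runs_nestedMaxima le_rfl rfl).append hb).append (runs_nestedMinima le_rfl rfl)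
  nodup := by simp [ labels, Piece.label, nestedMaxima, nestedMinima]
  mem_labels j := by simp [labels, Piece.label]

end Planar

/-! ### Elements drawn by labelled pictures -/

namespace PlanarAlgebra

variable {V : ℕ → Type*} [∀ n, AddCommGroup (V n)] [∀ n, Module ℂ (V n)] (P : PlanarAlgebra V)

/-- In both tangles every label occurs exactly once, which forces `f` to be a bijection; the claim
is then invariance under renumbering. -/
theorem act_map {ι κ : Type} (f : ι → κ) {k : κ → ℕ} {n : ℕ} (T : Tangle (k ∘ f) n)
    (T' : Tangle k n) (h : T.layers.map (Layer.shift 0 f) = T'.layers) (x : ∀ j, V (k j)) :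
    P.act T (fun i => x (f i)) = P.act T' x := by
  have hl : (labels T.layers).map f = labels T'.layers := by rw [← labels_shift f 0, h]
  have hf : Function.Bijective f := by
    constructor
    · intro i i' e
      exact List.inj_on_of_nodup_map (hl ▸ T'.nodup) (T.mem_labels i) (T.mem_labels i') e
    · intro j
      obtain ⟨i, -, e⟩ := List.mem_map.1 (hl ▸ T'.mem_labels j)
      exact ⟨i, e⟩
  obtain ⟨e, rfl⟩ : ∃ e : ι ≃ κ, ⇑e = f := ⟨Equiv.ofBijective f hf, rfl⟩
  have : T' = T.relabel e := by
    cases T'; subst h; rfl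
  rw [this, P.act_relabel]

/-- The picture `w`, with the elements `x j` put into its boxes, draws the element `v`. -/
def Draws {ι : Type} {k : ι → ℕ} (x : ∀ j, V (k j)) (n : ℕ) (w : List (Layer ι)) (v : V n) : Prop :=
  ∃ (κ : Type) (f : κ → ι) (T : Tangle (k ∘ f) n),
    T.layers.map (Layer.shift 0 f) = w ∧ P.act T (fun i => x (f i)) = v

variable {P}

theorem Draws.act_eq {ι : Type} {k : ι → ℕ} {x : ∀ j, V (k j)} {n : ℕ} {T : Tangle k n} {v : V n}
    (h : P.Draws x n T.layers v) : P.act T x = v := by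
  obtain ⟨κ, f, T', h, rfl⟩ := h
  exact (P.act_map f T' T h x).symm

/-- This is compatibility with gluing. No disjointness of the labels of the `w j` is needed, since
the map `f` in `Draws` need not be injective. -/
theorem Draws.act {ι ι' : Type} {k : ι → ℕ} {x : ∀ j, V (k j)} {n : ℕ} {k' : ι' → ℕ}
    (T : Tangle k' n) {w : ι' → List (Layer ι)} {v : ∀ j, V (k' j)}
    (h : ∀ j, P.Draws x (k' j) (w j) (v j)) :
    P.Draws x n (T.layers.flatMap (substitute w)) (P.act T v) := by
  choose κ f S hS hv using h
  refine ⟨Σ j, κ j, fun p => f p.1 p.2, T.glue S, ?_, ?_⟩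
  · simp only [Tangle.glue, List.map_flatMap, map_fill, hS]
  · rw [← funext hv]
    exact P.act_glue T S _

end PlanarAlgebra

/-! ### Fixed points and the induction on the number of boxes -/

section Coaction

variable {Z : Type*} [CStarAlgebra Z] {H : Type*} [NormedAddCommGroup H] [InnerProductSpace ℂ H]
  [CompleteSpace H] [PartialOrder Z] [StarOrderedRing Z]
  {V : ℕ → Type*} [∀ n, AddCommGroup (V n)] [∀ n, Module ℂ (V n)]
  {G : KacQuantumGroup Z H} {P : PlanarAlgebra V}

theorem GradedCoaction.mul_mem_fixedPoints (α : GradedCoaction G P) {n : ℕ} {x y : V n}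
    (hx : x ∈ α.fixedPoints n) (hy : y ∈ α.fixedPoints n) : P.mul n x y ∈ α.fixedPoints n := by
  change α.map n x = 1 ⊗ₜ x at hx
  change α.map n y = 1 ⊗ₜ y at hy
  change α.map n _ = 1 ⊗ₜ _
  rw [α.map_mul, hx, hy, TensorProduct.map₂_apply_tmul]
  simp

namespace PlanarCoaction

variable (α : PlanarCoaction G P)

/-- The picture `w`, with the elements `x j` put into its boxes, draws a fixed point. -/
def DrawsFixed {ι : Type} {k : ι → ℕ} (x : ∀ j, V (k j)) (n : ℕ) (w : List (Layer ι)) : Prop :=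
  ∃ v ∈ α.fixedPoints n, P.Draws x n w v

variable {α} {ι : Type} {k : ι → ℕ} {x : ∀ j, V (k j)}

theorem DrawsFixed.annular {n m t : ℕ} (h : m ≤ n + 2 * t) {w : List (Layer ι)}
    (hw : α.DrawsFixed x m w) : α.DrawsFixed x n (nestedMaxima n t ++ w ++ nestedMinima n t) := by
  obtain ⟨v, hv, hd⟩ := hw
  refine ⟨_, α.weakly_equivariant (Tangle.annular n m t h) (fun _ => v) fun _ => hv, ?_⟩
  have := PlanarAlgebra.Draws.act (P := P) (Tangle.annular n m t h) (fun _ => hd)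
  simpa [Tangle.annular, List.flatMap_append, flatMap_substitute_nestedMaxima,
    flatMap_substitute_nestedMinima, substitute, map_shift_zero_id] using this

theorem DrawsFixed.pad {n m : ℕ} (h : m ≤ n) {w : List (Layer ι)}
    (hw : α.DrawsFixed x m w) : α.DrawsFixed x n w := by
  simpa [nestedMaxima, nestedMinima] using hw.annular (t := 0) h

theorem DrawsFixed.append {n : ℕ} {w w' : List (Layer ι)}
    (hw : α.DrawsFixed x n w) (hw' : α.DrawsFixed x n w') : α.DrawsFixed x n (w ++ w') := by
  obtain ⟨v, hv, hd⟩ := hw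
  obtain ⟨v', hv', hd'⟩ := hw'
  -- The order is reversed because the first factor of a product is the lower box.
  refine ⟨_, α.mul_mem_fixedPoints hv' hv, ?_⟩
  have := PlanarAlgebra.Draws.act (P := P) (x := x) (Tangle.mul n) (w := ![w', w]) (v := ![v', v])
    (Fin.forall_fin_two.2 ⟨hd', hd⟩)
  have e : (Tangle.mul n).layers.flatMap (substitute ![w', w]) = w ++ w' := by
    simp [Tangle.mul, substitute, map_shift_zero_id]
  rwa [e] at this

variable (α) in
theorem act_mem_fixedPoints {n : ℕ} (T : Tangle k n) (hx : ∀ j, x j ∈ α.fixedPoints (k j)) :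
    P.act T x ∈ α.fixedPoints n := by
  induction hN : (labels T.layers).length using Nat.strong_induction_on generalizing ι n with
  | _ N ih =>
  rcases subsingleton_or_nontrivial ι with hι | hι
  · exact α.weakly_equivariant T x hx
  -- The induction hypothesis for square pictures using only some of the labels: such a picture is a
  -- tangle over the subset of labels that occur, so `ι` has to vary in the induction.
  have draws : ∀ {m : ℕ} {w : List (Layer ι)}, Runs k m w m → (labels w).Nodup →
      (labels w).length < N → α.DrawsFixed x m w := by
    intro m w hw hd hl
    obtain ⟨S, hS⟩ := exists_tangle_map_val hw hd
    refine ⟨_, ih _ hl (k := k ∘ Subtype.val) (x := fun j => x j.1) S (fun j => hx j.1) ?_, _, Subtype.val, S, hS, rfl⟩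
    rw [← List.length_map (f := Subtype.val), ← labels_shift Subtype.val 0, hS]
  obtain ⟨u, v, huv, hu, hv⟩ : ∃ u v, T.layers = u ++ v ∧ labels u ≠ [] ∧ labels v ≠ [] :=
    exists_split T.two_le_length_labels
  have hlab : labels T.layers = labels u ++ labels v := by rw [huv, labels_append]
  have hnd := T.nodup
  rw [hlab] at hnd hN
  rw [List.length_append] at hN
  have hu0 := List.length_pos_of_ne_nil hu
  have hv0 := List.length_pos_of_ne_nil hv
  have hrun := T.runs
  rw [huv] at hrun
  obtain ⟨m, hum, hvm⟩ := hrun.split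
  have hpar := hum.mod_two
  -- By isotopy invariance, `T` may be replaced by any picture isotopic to it.
  suffices h : ∃ w, PictureIsotopic k n n w T.layers ∧ α.DrawsFixed x n w by
    obtain ⟨w, hw, v, hv, hd⟩ := h
    obtain ⟨T', rfl⟩ := hw.exists_tangle.1.2 ⟨T, rfl⟩
    rw [← P.act_isotopic (hw.exists_tangle.2 T' T rfl rfl), hd.act_eq]
    exact hv
  rw [huv]
  rcases le_total m n with hmn | hmn
  · obtain ⟨t, rfl⟩ : ∃ t, n = m + 2 * t := ⟨(n - m) / 2, by omega⟩
    refine ⟨(nestedMaxima (m + 2 * t - t) t ++ u) ++ (nestedMinima m t ++ nestedMaxima m t) ++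
      (v ++ nestedMinima (m + 2 * t - t) t), ?_, ?_⟩
    -- The minima of the middle factor undo the bending of `u`, and its maxima undo the bending of
    -- `v`.
    · have e1 := (PictureIsotopic.bend_top hum (t := t) (by omega)).append_right hvm
      have e2 := (PictureIsotopic.bend_bottom hvm (t := t) (by omega)).append_left
        ((runs_nestedMaxima (k := k) (n := m + 2 * t) (a := m + 2 * t - t) (m := t) (by omega)
          rfl).append ((hum.add_right (2 * t)).append (runs_nestedMinima le_rfl rfl)))
      simp only [List.append_assoc] at e1 e2 ⊢
      exact e2.trans e1
    -- The outer factors have fewer boxes because `u` and `v` each contain one; the middle factor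
    -- has none.
    · refine ((DrawsFixed.pad (m := m + t) (by omega) (draws ?_ ?_ ?_)).append (draws ?_ ?_ ?_)).append
        (DrawsFixed.pad (m := m + t) (by omega) (draws ?_ ?_ ?_))
      · refine (runs_nestedMaxima (r := m + 2 * t + t) (by omega) (by omega)).append (hum.add_right t)
      · simpa [labels_append] using hnd.of_append_left
      · simp [labels_append]; omega
      · exact (runs_nestedMinima le_rfl rfl).append (runs_nestedMaxima le_rfl rfl)
      · simp [labels_append]
      · simp [labels_append]; omega
      · exact (hvm.add_right t).append (runs_nestedMinima (by omega) (by omega))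
      · simpa [labels_append] using hnd.of_append_right
      · simp [labels_append]; omega
  · obtain ⟨t, rfl⟩ : ∃ t, m = n + 2 * t := ⟨(m - n) / 2, by omega⟩
    refine ⟨nestedMaxima n t ++ ((u ++ nestedMinima (n + 2 * t - t) t) ++
      (nestedMaxima (n + 2 * t - t) t ++ v)) ++ nestedMinima n t, ?_, ?_⟩
    -- The maxima of the annular closure straighten `u`, and its minima straighten `v`.
    · have e1 := (PictureIsotopic.bend_bottom hum (t := t) (by omega)).append_right hvm
      have e2 := (PictureIsotopic.bend_top hvm (t := t) (by omega)).append_left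
        ((runs_nestedMaxima (k := k) (n := n) (a := n) (m := t) le_rfl
          rfl).append ((hum.add_right (2 * t)).append
          (runs_nestedMinima (a := n + 2 * t - t) (by omega) rfl)))
      simp only [List.append_assoc] at e1 e2 ⊢
      exact e2.trans e1
    · refine DrawsFixed.annular (m := n + 2 * t) le_rfl
        ((DrawsFixed.pad (m := n + t) (by omega) (draws ?_ ?_ ?_)).append
        (DrawsFixed.pad (m := n + t) (by omega) (draws ?_ ?_ ?_)))
      · exact (hum.add_right t).append (runs_nestedMinima (by omega) (by omega))
      · simpa [labels_append] using hnd.of_append_left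
      · simp [labels_append]; omega
      · refine (runs_nestedMaxima (r := n + 2 * t + t) (by omega) (by omega)).append (hvm.add_right t)
      · simpa [labels_append] using hnd.of_append_right
      · simp [labels_append]; omega

end PlanarCoaction

end Coaction

theorem proposition5p4 {Z : Type*} [CStarAlgebra Z] [PartialOrder Z] [StarOrderedRing Z]
    {H : Type*} [NormedAddCommGroup H] [InnerProductSpace ℂ H] [CompleteSpace H]
    (G : KacQuantumGroup Z H)
    {V : ℕ → Type*} [∀ n, AddCommGroup (V n)] [∀ n, Module ℂ (V n)]
    [∀ n, FiniteDimensional ℂ (V n)] (P : PlanarAlgebra V) (α : PlanarCoaction G P) :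
    ∃ Q : PlanarAlgebra (fun n => α.fixedPoints n),
      ∀ {ι : Type} {k : ι → ℕ} {n : ℕ} (T : Tangle k n) (x : ∀ j, α.fixedPoints (k j)),
        (Q.act T x : V n) = P.act T (fun j => (x j : V (k j))) := by
  -- The action is restricted and corestricted to the fixed points; each axiom is the one of `P`,
  -- read through the injective inclusion of the fixed points.
  refine ⟨
    { act := fun {ι k n} T => ((P.act T).compLinearMap
          fun j => (α.fixedPoints (k j)).subtype).codRestrict (α.fixedPoints n)
          fun x => α.act_mem_fixedPoints T fun j => (x j).2
      act_isotopic := fun h => ?_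
      act_relabel := fun e T x => ?_
      act_id := fun n x => ?_
      act_glue := fun T S x => ?_ }, fun T x => rfl⟩
  · ext x
    exact DFunLike.congr_fun (P.act_isotopic h) fun j => (x j : V _)
  · exact Subtype.ext (P.act_relabel e T _)
  · exact Subtype.ext (P.act_id n _)
  · exact Subtype.ext (P.act_glue T S _)
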